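/- Conventions. All linear spaces are real. For finite $t,s\subset\mathbb N$ write $t\sqsubseteq s$ if $t$ is an initial segment of $s$. For a family $\mathcal F$ of finite subsets of $\mathbb N$ let $\widehat{\mathcal F}=\{t:\ t\sqsubseteq s\text{ for some }s\in\mathcal F\}$, and for $M\subseteq\mathbb N$ let $\mathcal F\upharpoonright M=\{s\in\mathcal F: s\subseteq M\}$. $\mathcal F$ is regular thin if no member of $\mathcal F$ is a proper initial segment of another and $\widehat{\mathcal F}$ is hereditary, spreading ($\{n_1<\dots<n_k\}\in\widehat{\mathcal F}$, $m_1<\dots<m_k$ and $n_i\le m_i$ for all $i$ imply $\{m_1,\dots,m_k\}\in\widehat{\mathcal F}$) and compact (closed in $\{0,1\}^{\mathbb N}$ when sets are identified with characteristic functions). The order $o(\mathcal F)$ is the rank of $\emptyset$ in the tree $(\widehat{\mathcal F},\sqsubseteq)$, where the rank of $s$ is $\sup\{\operatorname{rank}(t)+1: t\in\widehat{\mathcal F},\ s\sqsubseteq t,\ s\ne t\}$. An $\mathcal F$-sequence in a Banach space $X$ is a family $(x_s)_{s\in\mathcal F}$ in $X$; it is weakly relatively compact if the weak closure of $\{x_s:s\in\mathcal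 F\}$ is weakly compact. Write $s(k)$, $M(k)$ for the $k$-th element of $s$, $M$. A tuple $(s_j)_{j=1}^l$ of nonempty finite sets is plegma if $s_i(k)<s_j(k)$ whenever $i<j$ and $k\le\min(|s_i|,|s_j|)$, and $s_i(k)<s_j(k+1)$ for all $i,j$ whenever $k\le\min(|s_i|,|s_j|-1)$. Let $E$ be a seminormed space with Hamel basis $(e_n)_{n\in\mathbb N}$, and let $M\subseteq\mathbb N$ be infinite. The subsequence $(x_s)_{s\in\mathcal F\upharpoonright M}$ generates $(e_n)_n$ as an $\mathcal F$-spreading model if there are positive reals $\delta_n\to0$ such that $$\Big|\Big\|\sum_{j=1}^k a_jx_{s_j}\Big\|-\Big\|\sum_{j=1}^k a_je_j\Big\|\Big|\le\delta_l$$ for all $1\le k\le l$, all plegma tuples $(s_j)_{j=1}^k$ in $\mathcal F\upharpoonright M$ with $s_1(1)\ge M(l)$ and all $a_1,\dots,a_k\in[-1,1]$. For a countable ordinal $\xi\ge1$, $(e_n)_n$ is a $\xi$-order spreading model of $A\subseteq X$ if there are a regular thin family $\mathcal F$ with $o(\mathcal F)=\xi$, an $\mathcal F$-sequence $(x_s)_{s\in\mathcal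 F}$ in $A$ and an infinite $M\subseteq\mathbb N$ such that $(x_s)_{s\in\mathcal F\upharpoonright M}$ generates $(e_n)_n$. Let $\mathcal{SM}^{wrc}(X)$ be the class of all $(e_n)_n$ that are a $\xi$-order spreading model, for some countable $\xi\ge1$, of some weakly relatively compact $A\subseteq X$. Such a sequence is Schauder basic if it is a Schauder basis of its closed linear span, and unconditional if there is $C>0$ such that, whenever $\sum_n a_ne_n$ converges and $S\subseteq\mathbb N$, the series $\sum_{n\in S}a_ne_n$ converges and $\|\sum_{n\in S}a_ne_n\|\le C\|\sum_na_ne_n\|$; closed span and convergence are taken in the completion of $E$. Theorem. Let $X$ be a Banach space. (1) Every Schauder basic sequence in $\mathcal{SM}^{wrc}(X)$ is unconditional. (2) Let $\mathcal F$ be a regular thin family and $(x_s)_{s\in\mathcal F}$ a weakly relatively compact $\mathcal F$-sequence in $X$. Then for every infinite $M\subseteq\mathbb N$ there is an infinite $L\subseteq M$ such that $(x_s)_{s\in\mathcal F\upharpoonright L}$ is subordinated with respect to the weak topology: there is a map $\widehat\varphi:\widehat{\mathcal F}\upharpoonright L\to(X,w)$, continuous for the topology of $\{0,1\}^{\mathbb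 N}$, with $\widehat\varphi(s)=x_s$ for all $s\in\mathcal F\upharpoonright L$. -/

import Mathlib

/-! Higher order spreading models of Banach spaces.

Finite subsets of the natural numbers are `Finset ℕ`, families of them are `Set (Finset ℕ)`.
The natural numbers start at `0` here and elements of a set are counted from `0`; all the
notions below depend only on the order of the natural numbers. -/

namespace SpreadingModel

open Filter Topology

/-! ### Families of finite subsets of the natural numbers -/

/-- `t ⊑ s`: the finite set `t` is an initial segment of `s`. -/
def IsInitSeg (t s : Finset ℕ) : Prop :=
  t ⊆ s ∧ ∀ a ∈ s, ∀ b ∈ t, a ≤ b → a ∈ t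

/-- The closure of a family: all initial segments of its members. -/
def segClosure (F : Set (Finset ℕ)) : Set (Finset ℕ) :=
  {t | ∃ s ∈ F, IsInitSeg t s}

/-- The restriction of a family: all its members that are subsets of `M`. -/
def restrict (F : Set (Finset ℕ)) (M : Set ℕ) : Set (Finset ℕ) :=
  {s | s ∈ F ∧ (s : Set ℕ) ⊆ M}

def IsHereditary (F : Set (Finset ℕ)) : Prop :=
  ∀ s ∈ F, ∀ t ⊆ s, t ∈ F

def IsSpreading (F : Set (Finset ℕ)) : Prop :=
  ∀ (k : ℕ) (n m : Fin k → ℕ), StrictMono n → StrictMono m → (∀ i, n i ≤ m i) →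
    Finset.univ.image n ∈ F → Finset.univ.image m ∈ F

/-- The characteristic function of a finite set, a point of the Cantor space. -/
def charFn (s : Finset ℕ) : ℕ → Bool := fun n => decide (n ∈ s)

/-- A family is compact if the characteristic functions of its members form a closed
subset of the Cantor space. -/
def IsCompactFamily (F : Set (Finset ℕ)) : Prop :=
  IsClosed (charFn '' F)

structure IsRegular (F : Set (Finset ℕ)) : Prop where
  compact : IsCompactFamily F
  hereditary : IsHereditary F
  spreading : IsSpreading F

def IsThin (F : Set (Finset ℕ)) : Prop :=
  ∀ s ∈ F, ∀ t ∈ F, IsInitSeg s t → s = t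

/-- Regular thin families: thin families whose closure is regular. -/
structure IsRegularThin (F : Set (Finset ℕ)) : Prop where
  thin : IsThin F
  regular : IsRegular (segClosure F)

/-- `treeRel F t s`: `s` and `t` lie in the closure of `F` and `t` properly extends `s`. -/
def treeRel (F : Set (Finset ℕ)) (t s : Finset ℕ) : Prop :=
  t ∈ segClosure F ∧ s ∈ segClosure F ∧ IsInitSeg s t ∧ s ≠ t

open Classical in
/-- The order of a family: the rank of the empty set in the tree `segClosure F`, where the
rank of `s` is the supremum of `rank t + 1` over the proper extensions `t` of `s`. It is
`ω₁` if the tree is ill-founded, and `⊥` (for `-1`) if the family is empty. -/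
noncomputable def order (F : Set (Finset ℕ)) : WithBot Ordinal.{0} :=
  if F = ∅ then ⊥
  else if h : WellFounded (treeRel F) then ((h.apply ∅).rank : Ordinal.{0})
  else (Ordinal.omega 1 : Ordinal.{0})

/-! ### Plegma families -/

/-- The plegma condition. Here `Nat.nth (· ∈ s) k` is the element of `s` with exactly `k`
elements of `s` below it; it is used only for `k < s.card`. -/
structure IsPlegma {l : ℕ} (s : Fin l → Finset ℕ) : Prop where
  nonempty : ∀ i, (s i).Nonempty
  lt_same : ∀ i j, i < j → ∀ k, k < (s i).card → k < (s j).card →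
    Nat.nth (· ∈ s i) k < Nat.nth (· ∈ s j) k
  lt_next : ∀ i j, ∀ k, k < (s i).card → k + 1 < (s j).card →
    Nat.nth (· ∈ s i) k < Nat.nth (· ∈ s j) (k + 1)

/-! ### Subordinated sequences

A sequence indexed by a family `F` is a map on `Finset ℕ` of which only the values on `F`
matter. -/

/-- The subsequence of `x` indexed by `restrict F M` is subordinated: it extends to a map on
`restrict (segClosure F) M` that is continuous for the topology of the Cantor space. -/
def IsSubordinated {Y : Type*} [TopologicalSpace Y] (F : Set (Finset ℕ)) (M : Set ℕ)
    (x : Finset ℕ → Y) : Prop :=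
  ∃ φ : (ℕ → Bool) → Y, ContinuousOn φ (charFn '' restrict (segClosure F) M) ∧
    ∀ s ∈ restrict F M, φ (charFn s) = x s

/-! ### Spreading models -/

section Models

variable {X : Type*} [NormedAddCommGroup X] [NormedSpace ℝ X]
variable {E : Type*} [SeminormedAddCommGroup E] [NormedSpace ℝ E]

/-- `A` is weakly relatively compact: its weak closure is weakly compact. -/
def IsWeaklyRelCompact (A : Set X) : Prop :=
  IsCompact (closure (toWeakSpace ℝ X '' A))

/-- The subsequence of `x` indexed by `restrict F M` generates the Hamel basis `e` of the
seminormed space `E` as a spreading model. The numbers `k + 1 ≤ l + 1` are the length of the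
plegma tuple and the index of the error; `Nat.nth (· ∈ M) l` is the `(l + 1)`-st element
of `M`, and `Nat.nth (· ∈ s 0) 0` the least element of `s 0`. -/
def Generates (F : Set (Finset ℕ)) (M : Set ℕ) (x : Finset ℕ → X)
    (e : Module.Basis ℕ ℝ E) : Prop :=
  ∃ δ : ℕ → ℝ, (∀ n, 0 < δ n) ∧ Tendsto δ atTop (𝓝 0) ∧
    ∀ k l : ℕ, k ≤ l → ∀ s : Fin (k + 1) → Finset ℕ, (∀ i, s i ∈ restrict F M) → IsPlegma s →
      Nat.nth (· ∈ M) l ≤ Nat.nth (· ∈ s 0) 0 →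
      ∀ a : Fin (k + 1) → ℝ, (∀ i, a i ∈ Set.Icc (-1 : ℝ) 1) →
        |‖∑ i, a i • x (s i)‖ - ‖∑ i, a i • e (i : ℕ)‖| ≤ δ l

/-- `e` is an `F`-spreading model of the set `A`: some `F`-sequence in `A` has a subsequence
that generates `e`. -/
def IsSpreadingModelOf (F : Set (Finset ℕ)) (A : Set X) (e : Module.Basis ℕ ℝ E) : Prop :=
  ∃ x : Finset ℕ → X, (∀ s ∈ F, x s ∈ A) ∧ ∃ M : Set ℕ, M.Infinite ∧ Generates F M x e

/-- `e` is a spreading model of order `ξ` of the set `A`. -/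
def IsSpreadingModelOfOrder (ξ : Ordinal.{0}) (A : Set X) (e : Module.Basis ℕ ℝ E) : Prop :=
  ∃ F : Set (Finset ℕ), IsRegularThin F ∧ order F = (ξ : WithBot Ordinal.{0}) ∧
    IsSpreadingModelOf F A e

variable (X E) in
/-- The spreading models (among the Hamel bases of the seminormed space `E`) of any countable
order `ξ ≥ 1` of weakly relatively compact subsets of `X`. -/
def wrcSpreadingModels : Set (Module.Basis ℕ ℝ E) :=
  {e | ∃ ξ : Ordinal.{0}, 1 ≤ ξ ∧ ξ < Ordinal.omega 1 ∧
    ∃ A : Set X, IsWeaklyRelCompact A ∧ IsSpreadingModelOfOrder ξ A e}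

end Models

/-! ### Schauder basic and unconditional sequences -/

section Sequences

variable {V : Type*} [NormedAddCommGroup V] [NormedSpace ℝ V]

/-- The sequence `x` is a Schauder basis of its closed linear span. -/
def IsSchauderBasic (x : ℕ → V) : Prop :=
  ∃ b : SchauderBasis ℝ (Submodule.span ℝ (Set.range x)).topologicalClosure,
    ∀ n, (b n : V) = x n

open Classical in
/-- The sequence `x` is `C`-unconditional for some `C > 0`: for every convergent series
`y = ∑ aₙ xₙ` and every set `S` of indices, the series `z = ∑_{n ∈ S} aₙ xₙ` converges,
and `‖z‖ ≤ C ‖y‖`. -/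
def IsUnconditional (x : ℕ → V) : Prop :=
  ∃ C : ℝ, 0 < C ∧ ∀ (S : Set ℕ) (a : ℕ → ℝ) (y : V),
    Tendsto (fun n => ∑ i ∈ Finset.range n, a i • x i) atTop (𝓝 y) →
    ∃ z : V, Tendsto (fun n => ∑ i ∈ Finset.range n, if i ∈ S then a i • x i else 0)
      atTop (𝓝 z) ∧ ‖z‖ ≤ C * ‖y‖

end Sequences

end SpreadingModel

namespace SpreadingModel

open Filter Topology

/-! ### Initial segments and the tree of a regular thin family -/

/-! Both parts rest on one construction. The tree `segClosure F` is well-founded, so a map on `F`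
with values in a compact set extends down to the root: at a node outside `F` the value is the limit,
along a fixed ultrafilter, of the values at the one-point extensions
(`IsRegularThin.exists_limit_map`).

For (2), the weak closure is compact and metrizable because `F` is countable. A sufficiently sparse
`L` makes the `k`-th element of `L` move the extension by less than `(1 / 2) ^ k`, and continuity
follows by summing a geometric series.

For (1), let `x₀` be the value at the root. Mazur's lemma at each node puts `x₀` near the convex
hull of the `x s` with `s` in a prescribed pattern of intervals; interleaved patterns make every
selection plegma (`Generates.exists_center`). In a combination with coefficients `c`, replacing the
terms outside `S` by such convex combinations leaves the terms in `S` plus a multiple of `x₀`, with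
norm at most about `‖∑ c i • e i‖`. The same holds for indices shifted by `n`, with the same
multiple of `x₀`. Subtracting cancels `x₀` (`norm_sum_sub_shift_le`), and a basis projection removes
the shifted block. -/

theorem IsInitSeg.trans {s t u : Finset ℕ} (h : IsInitSeg s t) (h' : IsInitSeg t u) :
    IsInitSeg s u :=
  ⟨h.1.trans h'.1, fun a ha b hb hab => h.2 a (h'.2 a ha b (h.1 hb) hab) b hb hab⟩

theorem isInitSeg_empty (s : Finset ℕ) : IsInitSeg ∅ s :=
  ⟨Finset.empty_subset s, fun _ _ b hb => absurd hb (Finset.notMem_empty b)⟩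

theorem isInitSeg_insert {t : Finset ℕ} {n : ℕ} (h : ∀ m ∈ t, m < n) :
    IsInitSeg t (insert n t) := by
  refine ⟨Finset.subset_insert n t, fun a ha b hb hab => ?_⟩
  rcases Finset.mem_insert.1 ha with rfl | ha
  · exact absurd hab (not_le.2 (h b hb))
  · exact ha

/-- A proper initial segment of `s` extends by one element to an initial segment of `s`. -/
theorem IsInitSeg.exists_insert {t s : Finset ℕ} (h : IsInitSeg t s) (hne : t ≠ s) :
    ∃ n ∈ s, (∀ m ∈ t, m < n) ∧ IsInitSeg (insert n t) s ∧
      ∀ m ∈ s, m ∉ t → n ≤ m := by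
  have hd : (s \ t).Nonempty :=
    Finset.sdiff_nonempty.2 fun hst => hne (h.1.antisymm hst)
  obtain ⟨n, hn, hmin⟩ := (s \ t).exists_min_image id hd
  rw [Finset.mem_sdiff] at hn
  have hlt : ∀ m ∈ t, m < n := fun m hm => by
    by_contra hle
    exact hn.2 (h.2 n hn.1 m hm (not_lt.1 hle))
  refine ⟨n, hn.1, hlt, ⟨Finset.insert_subset hn.1 h.1, fun a ha b hb hab => ?_⟩,
    fun m hm hmt => hmin m (Finset.mem_sdiff.2 ⟨hm, hmt⟩)⟩
  by_cases hat : a ∈ t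
  · exact Finset.mem_insert_of_mem hat
  · have hna : n ≤ a := hmin a (Finset.mem_sdiff.2 ⟨ha, hat⟩)
    rcases Finset.mem_insert.1 hb with rfl | hb
    · rw [le_antisymm hab hna]
      exact Finset.mem_insert_self _ _
    · exact absurd (hab.trans_lt (hlt b hb)) (not_lt.2 hna)

theorem IsInitSeg.mem_segClosure {F : Set (Finset ℕ)} {t s : Finset ℕ} (h : IsInitSeg t s)
    (hs : s ∈ segClosure F) : t ∈ segClosure F :=
  let ⟨u, hu, hsu⟩ := hs
  ⟨u, hu, h.trans hsu⟩

theorem IsThin.eq_of_isInitSeg {F : Set (Finset ℕ)} (hF : IsThin F) {t s : Finset ℕ}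
    (ht : t ∈ F) (hs : s ∈ segClosure F) (h : IsInitSeg t s) : t = s := by
  obtain ⟨u, hu, hsu⟩ := hs
  have htu := hF t ht u hu (h.trans hsu)
  subst htu
  exact h.1.antisymm hsu.1

/-- Moving the largest element `n` up to `m` is an increasing map of `insert n t` that lowers no
element. -/
theorem IsSpreading.insert_mem {G : Set (Finset ℕ)} (hG : IsSpreading G) {t : Finset ℕ} {n m : ℕ}
    (hn : ∀ i ∈ t, i < n) (hnm : n ≤ m) (h : insert n t ∈ G) : insert m t ∈ G := by
  set f : ℕ → ℕ := fun i => if i = n then m else i with hf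
  have hmono : StrictMonoOn f (insert n t : Finset ℕ) := by
    intro i hi j hj hij
    simp only [Finset.coe_insert, Set.mem_insert_iff, Finset.mem_coe] at hi hj
    simp only [hf]
    rcases hi with rfl | hi
    · rcases hj with rfl | hj
      · exact absurd hij (lt_irrefl _)
      · exact absurd hij (hn j hj).le.not_gt
    · rw [if_neg (hn i hi).ne]
      rcases hj with rfl | hj
      · rw [if_pos rfl]
        exact hij.trans_le hnm
      · rwa [if_neg (hn j hj).ne]
  set g := (insert n t).orderEmbOfFin rfl
  have hg : Finset.univ.image g = insert n t := by
    ext i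
    rw [← Finset.mem_coe, Finset.coe_image, Finset.coe_univ, Set.image_univ,
      Finset.range_orderEmbOfFin, Finset.mem_coe]
  have hfg := hG _ g (f ∘ g) g.strictMono
    (fun i j hij => hmono (Finset.orderEmbOfFin_mem _ _ i) (Finset.orderEmbOfFin_mem _ _ j)
      (g.strictMono hij))
    (fun i => by
      simp only [hf, Function.comp_apply]
      split_ifs with hi
      · exact hi.trans_le hnm
      · exact le_rfl) (by rwa [hg])
  rw [← Finset.image_image, hg, Finset.image_insert] at hfg
  have htf : t.image f = t := by
    rw [Finset.image_congr (g := id), Finset.image_id]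
    intro i hi
    simp [hf, (hn i hi).ne]
  rwa [htf, show f n = m from if_pos rfl] at hfg

/-- A node of the tree that is not in the family has all one-point extensions by large
numbers in the tree. -/
theorem IsRegularThin.exists_forall_insert_mem {F : Set (Finset ℕ)} (hF : IsRegularThin F)
    {t : Finset ℕ} (ht : t ∈ segClosure F) (htF : t ∉ F) :
    ∃ N, ∀ n, N ≤ n → (∀ m ∈ t, m < n) ∧ insert n t ∈ segClosure F := by
  obtain ⟨s, hs, hts⟩ := ht
  obtain ⟨N, -, hlt, hN, -⟩ := hts.exists_insert (fun h => htF (h ▸ hs))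
  exact ⟨N, fun n hn => ⟨fun m hm => (hlt m hm).trans_le hn,
    hF.regular.spreading.insert_mem hlt hn ⟨s, hs, hN⟩⟩⟩

theorem treeRel_insert {F : Set (Finset ℕ)} {t : Finset ℕ} {n : ℕ} (h : ∀ m ∈ t, m < n)
    (hn : insert n t ∈ segClosure F) : treeRel F (insert n t) t :=
  ⟨hn, (isInitSeg_insert h).mem_segClosure hn, isInitSeg_insert h,
    fun he => lt_irrefl n (h n (he ▸ Finset.mem_insert_self n t))⟩

/-! ### Well-foundedness of the tree and ultrafilter limits along it -/

theorem charFn_injective : Function.Injective charFn := by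
  intro s t h
  ext n
  simpa [charFn] using congrFun h n

/-- Along an infinite branch the characteristic functions converge to that of the union. Compactness
makes the union a finite set, while the cardinalities along the branch are unbounded. -/
theorem wellFounded_treeRel {F : Set (Finset ℕ)} (hF : IsCompactFamily (segClosure F)) :
    WellFounded (treeRel F) := by
  rw [wellFounded_iff_isEmpty_descending_chain]
  refine ⟨fun ⟨f, hf⟩ => ?_⟩
  have hss : ∀ k, f k ⊂ f (k + 1) := fun k =>
    (hf k).2.2.1.1.ssubset_of_ne (hf k).2.2.2
  have hmono : StrictMono f := strictMono_nat_of_lt_succ hss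
  classical
  have hlim : Tendsto (fun k => charFn (f k)) atTop
      (𝓝 fun n => decide (∃ k, n ∈ f k)) := by
    rw [tendsto_pi_nhds]
    intro n
    refine tendsto_const_nhds.congr' ?_
    by_cases hn : ∃ k, n ∈ f k
    · obtain ⟨k, hk⟩ := hn
      filter_upwards [eventually_ge_atTop k] with j hj
      have hnj : n ∈ f j := hmono.monotone hj hk
      simp only [charFn, hnj, decide_true, decide_eq_true_eq]
      exact ⟨k, hk⟩
    · refine Eventually.of_forall fun j => ?_
      have hnj : n ∉ f j := fun h => hn ⟨j, h⟩
      simp [charFn, hn, hnj]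
  obtain ⟨s, -, hs⟩ := IsClosed.mem_of_tendsto hF hlim
    (Eventually.of_forall fun k => ⟨f k, (hf k).2.1, rfl⟩)
  have hsub : ∀ k, f k ⊆ s := fun k n hn => by
    have := congrFun hs n
    simpa [charFn, show ∃ k, n ∈ f k from ⟨k, hn⟩] using this
  have hcard : StrictMono fun k => (f k).card := fun i j hij => Finset.card_lt_card (hmono hij)
  exact absurd (hcard.le_apply (x := s.card + 1)) (not_le.2
    (Nat.lt_succ_of_le (Finset.card_le_card (hsub _))))

/-- A map on the tree that takes values in a compact set `K`, extends `x` and, at the nodes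
outside the family, is the limit along an ultrafilter of its values at the one-point extensions. -/
theorem IsRegularThin.exists_limit_map {Y : Type*} [TopologicalSpace Y] {F : Set (Finset ℕ)}
    (hF : IsRegularThin F) (U : Ultrafilter ℕ) (hU : (U : Filter ℕ) ≤ atTop) {K : Set Y}
    (hK : IsCompact K) (x : Finset ℕ → Y) (hx : ∀ s ∈ F, x s ∈ K) :
    ∃ φ : Finset ℕ → Y, (∀ s ∈ F, φ s = x s) ∧ ∀ t ∈ segClosure F, φ t ∈ K ∧
      (t ∉ F → Tendsto (fun n => φ (insert n t)) U (𝓝 (φ t))) := by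
  classical
  have hwf := wellFounded_treeRel hF.regular.compact
  let : Nonempty Y := ⟨x ∅⟩
  -- Well-founded recursion towards the root. The default `x ∅` is harmless: for `t` in the tree but
  -- not in `F`, large `n` give extensions in the tree.
  let G : (t : Finset ℕ) → ((s : Finset ℕ) → treeRel F s t → Y) → Y := fun t rec =>
    if t ∈ F then x t else Classical.epsilon fun y => y ∈ K ∧
      Tendsto (fun n => if h : treeRel F (insert n t) t then rec _ h else x ∅) U (𝓝 y)
  have hφ : ∀ t, hwf.fix G t = G t fun s _ => hwf.fix G s := fun t => hwf.fix_eq G t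
  have hφF : ∀ s ∈ F, hwf.fix G s = x s := fun s hs => by
    rw [hφ]
    exact if_pos hs
  refine ⟨hwf.fix G, hφF, fun t => ?_⟩
  induction t using hwf.induction with
  | _ t ih =>
  intro ht
  by_cases htF : t ∈ F
  · exact ⟨(hφF t htF).symm ▸ hx t htF, fun h => absurd htF h⟩
  obtain ⟨N, hN⟩ := hF.exists_forall_insert_mem ht htF
  have hev : ∀ᶠ n in (U : Filter ℕ), treeRel F (insert n t) t := by
    filter_upwards [hU (eventually_ge_atTop N)] with n hn
    exact treeRel_insert (hN n hn).1 (hN n hn).2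
  have hle : ((U.map fun n => hwf.fix G (insert n t) : Ultrafilter Y) : Filter Y) ≤ 𝓟 K := by
    rw [le_principal_iff, Ultrafilter.coe_map, mem_map]
    filter_upwards [hev] with n hn
    exact (ih _ hn hn.1).1
  obtain ⟨y, hyK, hy⟩ := hK.ultrafilter_le_nhds _ hle
  have key : ∀ z, Tendsto (fun n => if h : treeRel F (insert n t) t
      then hwf.fix G (insert n t) else x ∅) U (𝓝 z) ↔
      Tendsto (fun n => hwf.fix G (insert n t)) U (𝓝 z) := fun z => by
    refine tendsto_congr' ?_
    filter_upwards [hev] with n hn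
    exact dif_pos hn
  have hspec := Classical.epsilon_spec (p := fun y => y ∈ K ∧ Tendsto (fun n =>
    if h : treeRel F (insert n t) t then hwf.fix G (insert n t) else x ∅) U (𝓝 y))
    ⟨y, hyK, (key y).2 hy⟩
  have ht' : hwf.fix G t = Classical.epsilon fun y => y ∈ K ∧ Tendsto (fun n =>
    if h : treeRel F (insert n t) t then hwf.fix G (insert n t) else x ∅) U (𝓝 y) := by
    rw [hφ]
    exact if_neg htF
  rw [← ht'] at hspec
  exact ⟨hspec.1, fun _ => (key _).1 hspec.2⟩

theorem _root_.Set.Infinite.exists_ultrafilter_le_atTop {M : Set ℕ} (hM : M.Infinite) :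
    ∃ U : Ultrafilter ℕ, (U : Filter ℕ) ≤ atTop ∧ M ∈ U := by
  have : NeBot (atTop ⊓ 𝓟 M) := by
    rw [← Nat.cofinite_eq_atTop]
    exact cofinite_inf_principal_neBot_iff.2 hM
  exact ⟨Ultrafilter.of (atTop ⊓ 𝓟 M), (Ultrafilter.of_le _).trans inf_le_left,
    Ultrafilter.of_le (atTop ⊓ 𝓟 M) (mem_inf_of_right (mem_principal_self M))⟩

end SpreadingModel

namespace SpreadingModel

open Filter Topology

/-! ### Subordinated subsequences -/

/-- Each new point only has to serve the finitely many sets below it, so the ultrafilter supplies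
one that is good for all of them at once. -/
theorem exists_strictMono_dist_insert_lt {T : Type*} [PseudoMetricSpace T] {G : Set (Finset ℕ)}
    {φ : Finset ℕ → T} {U : Ultrafilter ℕ} (hU : (U : Filter ℕ) ≤ atTop)
    (hφ : ∀ t ∈ G, Tendsto (fun n => φ (insert n t)) U (𝓝 (φ t))) {M : Set ℕ} (hM : M ∈ U) :
    ∃ ℓ : ℕ → ℕ, StrictMono ℓ ∧ ∀ k, ℓ k ∈ M ∧ ∀ t ∈ G, (t : Set ℕ) ⊆ Set.range ℓ →
      (∀ m ∈ t, m < ℓ k) → dist (φ t) (φ (insert (ℓ k) t)) < (1 / 2) ^ k := by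
  have hstep : ∀ A k : ℕ, ∃ n, A ≤ n ∧ n ∈ M ∧ ∀ t ∈ (Finset.range A).powerset, t ∈ G →
      dist (φ t) (φ (insert n t)) < (1 / 2) ^ k := by
    intro A k
    have h : ∀ᶠ n in (U : Filter ℕ), ∀ t ∈ (Finset.range A).powerset, t ∈ G →
        dist (φ t) (φ (insert n t)) < (1 / 2) ^ k := by
      rw [Finset.eventually_all]
      intro t _
      by_cases htG : t ∈ G
      · filter_upwards [Metric.tendsto_nhds.1 (hφ t htG) ((1 / 2) ^ k) (by positivity)] with n hn _
        rwa [dist_comm]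
      · exact Eventually.of_forall fun n h => absurd h htG
    obtain ⟨n, h1, h2, h3⟩ := ((Eventually.filter_mono hU (eventually_ge_atTop A)).and
      ((show ∀ᶠ n in (U : Filter ℕ), n ∈ M from hM).and h)).exists
    exact ⟨n, h1, h2, h3⟩
  choose f hfA hfM hf using hstep
  let ℓ : ℕ → ℕ := fun k => Nat.rec (f 0 0) (fun k a => f (a + 1) (k + 1)) k
  have hsucc : ∀ k, ℓ (k + 1) = f (ℓ k + 1) (k + 1) := fun _ => rfl
  have hmono : StrictMono ℓ := strictMono_nat_of_lt_succ fun k => by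
    rw [hsucc]
    exact hfA _ _
  refine ⟨ℓ, hmono, fun k => ?_⟩
  obtain ⟨A, hA, hAℓ⟩ : ∃ A, ℓ k = f A k ∧ ∀ j, j < k → ℓ j < A := by
    cases k with
    | zero => exact ⟨0, rfl, fun j hj => absurd hj (Nat.not_lt_zero j)⟩
    | succ k => exact ⟨ℓ k + 1, rfl, fun j hj =>
        Nat.lt_succ_of_le (hmono.monotone (Nat.lt_succ_iff.1 hj))⟩
  rw [hA]
  refine ⟨hfM _ _, fun t htG htℓ ht => hf A k t (Finset.mem_powerset.2 fun m hm => ?_) htG⟩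
  obtain ⟨j, rfl⟩ := htℓ hm
  exact Finset.mem_range.2 (hAℓ j (hmono.lt_iff_lt.1 ((ht _ hm).trans_eq hA.symm)))

theorem IsRegularThin.exists_subordinated_of_compactSpace {T : Type*} [PseudoMetricSpace T]
    [CompactSpace T] {F : Set (Finset ℕ)} (hF : IsRegularThin F) (x : Finset ℕ → T) {M : Set ℕ}
    (hM : M.Infinite) : ∃ L ⊆ M, L.Infinite ∧ IsSubordinated F L x := by
  obtain ⟨U, hU, hMU⟩ := hM.exists_ultrafilter_le_atTop
  obtain ⟨φ, hφx, hφ⟩ := hF.exists_limit_map U hU isCompact_univ x fun s _ => Set.mem_univ _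
  obtain ⟨ℓ, hmono, hℓ⟩ := exists_strictMono_dist_insert_lt (G := segClosure F \ F) hU
    (fun t ht => (hφ t ht.1).2 ht.2) hMU
  -- Walk from `t` to `s` one element at a time. If the next element is `ℓ j` with `k ≤ j`, it costs
  -- `(1 / 2) ^ j`, and the rest at most `2 * (1 / 2) ^ (j + 1)`.
  have hdist : ∀ s ∈ segClosure F, (s : Set ℕ) ⊆ Set.range ℓ → ∀ (d k : ℕ) (t : Finset ℕ),
      (s \ t).card = d → IsInitSeg t s → (∀ m ∈ s, m ∉ t → ℓ k ≤ m) →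
      dist (φ t) (φ s) ≤ 2 * (1 / 2) ^ k := by
    intro s hs hsℓ d
    induction d with
    | zero =>
      intro k t hd hts _
      rw [Finset.card_eq_zero, Finset.sdiff_eq_empty_iff_subset] at hd
      rw [hts.1.antisymm hd, dist_self]
      positivity
    | succ d ih =>
      intro k t hd hts hk
      have hne : t ≠ s := by
        rintro rfl
        simp at hd
      obtain ⟨n, hn, hlt, hseg, hmin⟩ := hts.exists_insert hne
      have hnt : n ∉ t := fun h => lt_irrefl n (hlt n h)
      obtain ⟨j, rfl⟩ := hsℓ hn
      have htF : t ∉ F := fun h => hne (hF.thin.eq_of_isInitSeg h hs hts)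
      have h1 := (hℓ j).2 t ⟨hts.mem_segClosure hs, htF⟩
        ((Finset.coe_subset.2 hts.1).trans hsℓ) hlt
      have h2 := ih (j + 1) (insert (ℓ j) t) (by
          rw [Finset.sdiff_insert, Finset.card_erase_of_mem (Finset.mem_sdiff.2 ⟨hn, hnt⟩), hd]
          rfl) hseg (fun m hm hmt => by
          obtain ⟨i, rfl⟩ := hsℓ hm
          rw [Finset.mem_insert, not_or] at hmt
          exact hmono.monotone (hmono.lt_iff_lt.1
            (lt_of_le_of_ne (hmin _ hm hmt.2) (Ne.symm hmt.1))))
      have h3 : (1 / 2 : ℝ) ^ j ≤ (1 / 2) ^ k :=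
        pow_le_pow_of_le_one (by norm_num) (by norm_num) (hmono.le_iff_le.1 (hk _ hn hnt))
      have h4 := dist_triangle (φ t) (φ (insert (ℓ j) t)) (φ s)
      rw [pow_succ] at h2
      linarith
  refine ⟨Set.range ℓ, Set.range_subset_iff.2 fun k => (hℓ k).1,
    Set.infinite_range_of_injective hmono.injective,
    Function.extend charFn φ fun _ => x ∅, ?_, fun s hs => ?_⟩
  · rintro _ ⟨t, -, rfl⟩
    rw [ContinuousWithinAt, Metric.tendsto_nhds]
    intro ε hε
    obtain ⟨k, hk⟩ := exists_pow_lt_of_lt_one (half_pos hε) (by norm_num : (1 / 2 : ℝ) < 1)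
    -- Agreement up to the maximum of `t` makes `t` an initial segment of `s`; agreement below `ℓ k`
    -- pushes the new elements of `s` to `ℓ k` or beyond.
    have hev : ∀ᶠ f in 𝓝 (charFn t), ∀ i ∈ Finset.range (ℓ k) ∪ Finset.range (t.sup id + 1),
        f i = charFn t i := by
      rw [Finset.eventually_all]
      exact fun i _ => (continuous_apply i).continuousAt.preimage_mem_nhds
        ((isOpen_discrete {charFn t i}).mem_nhds rfl)
    filter_upwards [mem_nhdsWithin_of_mem_nhds hev, self_mem_nhdsWithin]
    rintro _ hf ⟨s, ⟨hs, hsℓ⟩, rfl⟩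
    rw [charFn_injective.extend_apply, charFn_injective.extend_apply, dist_comm]
    have hiff : ∀ i, i < ℓ k ∨ i < t.sup id + 1 → (i ∈ s ↔ i ∈ t) := fun i hi => by
      simpa [charFn] using hf i (by simpa using hi)
    have hle : ∀ i ∈ t, i < t.sup id + 1 := fun i hi =>
      Nat.lt_succ_of_le (Finset.le_sup (f := id) hi)
    refine (hdist s hs hsℓ _ k t rfl ⟨fun i hi => (hiff i (Or.inr (hle i hi))).2 hi,
      fun a ha b hb hab => (hiff a (Or.inr (hab.trans_lt (hle b hb)))).1 ha⟩
      fun m hm hmt => ?_).trans_lt (by linarith)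
    by_contra hlt
    exact hmt ((hiff m (Or.inl (not_le.1 hlt))).1 hm)
  · rw [charFn_injective.extend_apply]
    exact hφx s hs.1

theorem IsRegularThin.exists_subordinated_of_metrizableSpace {Y : Type*} [TopologicalSpace Y]
    {F : Set (Finset ℕ)} (hF : IsRegularThin F) {K : Set Y} (hK : IsCompact K)
    [TopologicalSpace.MetrizableSpace K] (x : Finset ℕ → Y) (hx : ∀ s ∈ F, x s ∈ K) {M : Set ℕ}
    (hM : M.Infinite) : ∃ L ⊆ M, L.Infinite ∧ IsSubordinated F L x := by
  classical
  rcases F.eq_empty_or_nonempty with rfl | ⟨s₀, hs₀⟩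
  · exact ⟨M, subset_rfl, hM, fun _ => x ∅, continuousOn_const,
      fun s hs => absurd hs.1 (Set.notMem_empty s)⟩
  have : CompactSpace K := isCompact_iff_compactSpace.1 hK
  let := TopologicalSpace.metrizableSpaceMetric K
  obtain ⟨L, hLM, hL, φ, hφ, hφx⟩ := hF.exists_subordinated_of_compactSpace
    (fun s => if h : s ∈ F then (⟨x s, hx s h⟩ : K) else ⟨x s₀, hx s₀ hs₀⟩) hM
  refine ⟨L, hLM, hL, fun f => φ f, continuous_subtype_val.comp_continuousOn hφ, fun s hs => ?_⟩
  simp only [hφx s hs, dif_pos hs.1]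

/-! ### Metrizability of weakly compact closures of countable sets -/

section Weak

variable {X : Type*} [NormedAddCommGroup X] [NormedSpace ℝ X]

/-- Countably many functionals separate the points of a separable closed subspace. -/
theorem _root_.Submodule.exists_seq_strongDual_separating (V : Submodule ℝ X)
    (hV : TopologicalSpace.IsSeparable (V : Set X)) :
    ∃ f : ℕ → StrongDual ℝ X, ∀ v ∈ V, (∀ n, f n v = 0) → v = 0 := by
  obtain ⟨c, hcV, hc, hcd⟩ := hV.exists_countable_dense_subset
  have hne : c.Nonempty := by
    rw [← closure_nonempty_iff]
    exact ⟨0, hcd V.zero_mem⟩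
  obtain ⟨d, rfl⟩ := hc.exists_eq_range hne
  choose f hf hfd using fun n => exists_dual_vector'' ℝ (d n)
  refine ⟨f, fun v hv h => ?_⟩
  by_contra hv0
  obtain ⟨_, ⟨n, rfl⟩, hn⟩ := Metric.mem_closure_iff.1 (hcd hv) (‖v‖ / 2)
    (half_pos (norm_pos_iff.2 hv0))
  rw [dist_eq_norm] at hn
  -- The functional norming `d n` vanishes at `v`, so it sees all of `‖d n‖` in `v - d n`. Hence
  -- `‖v‖ ≤ 2 * ‖v - d n‖ < ‖v‖`.
  have h1 : ‖d n‖ ≤ ‖v - d n‖ := by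
    have h2 : f n (v - d n) = -‖d n‖ := by simp [h n, hfd n]
    have h3 := (f n).le_of_opNorm_le (hf n) (v - d n)
    rwa [h2, norm_neg, norm_norm, one_mul] at h3
  have h2 := norm_sub_le (v - d n) (-d n)
  have h3 : ‖v‖ ≤ ‖v - d n‖ + ‖d n‖ := by simpa using norm_add_le (v - d n) (d n)
  linarith

/-- The weak closure stays inside the closed span of `A`, which is separable and, being convex,
weakly closed. Countably many functionals separate its points, which metrizes a compact space. -/
theorem metrizableSpace_weakClosure_of_countable {A : Set X} (hA : A.Countable)
    (hK : IsCompact (closure (toWeakSpace ℝ X '' A))) :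
    TopologicalSpace.MetrizableSpace (closure (toWeakSpace ℝ X '' A)) := by
  have : CompactSpace (closure (toWeakSpace ℝ X '' A)) := isCompact_iff_compactSpace.1 hK
  set V := (Submodule.span ℝ A).topologicalClosure
  have hsub : closure (toWeakSpace ℝ X '' A) ⊆ toWeakSpace ℝ X '' V := by
    have h1 : (V : Set X) = closure (Submodule.span ℝ A : Set X) :=
      Submodule.topologicalClosure_coe _
    rw [h1, (Submodule.span ℝ A).convex.toWeakSpace_closure ℝ]
    exact closure_mono (Set.image_mono Submodule.subset_span)
  obtain ⟨f, hf⟩ := V.exists_seq_strongDual_separating hA.isSeparable.span.closure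
  refine Metric.PiNatEmbed.TopologicalSpace.MetrizableSpace.of_countable_separating
    (fun n (y : closure (toWeakSpace ℝ X '' A)) => f n ((toWeakSpace ℝ X).symm y))
    (fun n => (WeakBilin.eval_continuous (topDualPairing ℝ X).flip (f n)).comp
      continuous_subtype_val) fun y z hyz => ?_
  by_contra! h
  obtain ⟨v, hv, hvy⟩ := hsub y.2
  obtain ⟨w, hw, hwz⟩ := hsub z.2
  refine hyz (Subtype.ext ?_)
  rw [← hvy, ← hwz, ← sub_eq_zero.1 (hf (v - w) (V.sub_mem hv hw) fun n => ?_)]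
  have := h n
  rwa [← hvy, ← hwz, LinearEquiv.symm_apply_apply, LinearEquiv.symm_apply_apply, ← sub_eq_zero,
    ← map_sub] at this

theorem IsRegularThin.exists_weakly_subordinated {F : Set (Finset ℕ)} (hF : IsRegularThin F)
    {x : Finset ℕ → X} (hx : IsWeaklyRelCompact (x '' F)) {M : Set ℕ} (hM : M.Infinite) :
    ∃ L ⊆ M, L.Infinite ∧ IsSubordinated F L fun s => toWeakSpace ℝ X (x s) := by
  have := metrizableSpace_weakClosure_of_countable (F.to_countable.image x) hx
  exact hF.exists_subordinated_of_metrizableSpace hx _ (fun s hs =>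
    subset_closure (Set.mem_image_of_mem _ (Set.mem_image_of_mem x hs))) hM

end Weak

end SpreadingModel

namespace SpreadingModel

open Filter Topology Pointwise

/-! ### Convex combinations over plegma tuples -/

section Blocks

variable {X : Type*} [NormedAddCommGroup X] [NormedSpace ℝ X]

/-- Mazur's lemma, with the number of terms of the convex combination bounded. -/
theorem eventually_exists_mem_convexHull_dist_lt {u : ℕ → X} {y : X} {U : Filter ℕ} [NeBot U]
    (hu : Tendsto (fun n => toWeakSpace ℝ X (u n)) U (𝓝 (toWeakSpace ℝ X y))) {S : Set ℕ}
    (hS : S ∈ U) {η : ℝ} (hη : 0 < η) :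
    ∀ᶠ A in atTop, ∃ z ∈ convexHull ℝ (u '' (S ∩ Set.Iio A)), dist z y < η := by
  have hcl : toWeakSpace ℝ X y ∈ closure (toWeakSpace ℝ X '' convexHull ℝ (u '' S)) :=
    mem_closure_of_tendsto hu (mem_of_superset hS fun n hn =>
      Set.mem_image_of_mem _ (subset_convexHull ℝ _ (Set.mem_image_of_mem u hn)))
  rw [← (convex_convexHull ℝ (u '' S)).toWeakSpace_closure ℝ,
    (toWeakSpace ℝ X).injective.mem_set_image] at hcl
  obtain ⟨z, hz, hzy⟩ := Metric.mem_closure_iff.1 hcl η hη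
  rw [convexHull_eq_union_convexHull_finite_subsets] at hz
  simp only [Set.mem_iUnion] at hz
  classical
  obtain ⟨w, hw, hzw⟩ := hz
  obtain ⟨s, hs, rfl⟩ := Finset.subset_set_image_iff.1 hw
  filter_upwards [eventually_gt_atTop (s.sup id)] with A hA
  refine ⟨z, convexHull_mono ?_ hzw, by rwa [dist_comm]⟩
  rw [Finset.coe_image]
  exact Set.image_mono fun n hn => ⟨hs hn, (Finset.le_sup (f := id) hn).trans_lt hA⟩

/-- Only finitely many `t` lie below `a m`. Mazur's lemma applies to each of them, and `a (m + 1)`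
is chosen beyond all the finitely many extensions used. -/
theorem IsRegularThin.exists_strictMono_convexHull {F : Set (Finset ℕ)} (hF : IsRegularThin F)
    {φ : Finset ℕ → X} {U : Ultrafilter ℕ} (hU : (U : Filter ℕ) ≤ atTop)
    (hφ : ∀ t ∈ segClosure F, t ∉ F →
      Tendsto (fun n => toWeakSpace ℝ X (φ (insert n t))) U (𝓝 (toWeakSpace ℝ X (φ t))))
    {M : Set ℕ} (hM : M ∈ U) (N : ℕ) {ε : ℝ} (hε : 0 < ε) :
    ∃ a : ℕ → ℕ, StrictMono a ∧ N ≤ a 0 ∧ ∀ m, ∀ t ∈ segClosure F, t ∉ F →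
      (∀ i ∈ t, i < a m) → ∃ z ∈ convexHull ℝ ((fun n => φ (insert n t)) ''
        {n | n ∈ M ∧ a m ≤ n ∧ n < a (m + 1) ∧ insert n t ∈ segClosure F}),
        dist z (φ t) < ε * (1 / 2) ^ (m + 1) := by
  have hstep : ∀ A m : ℕ, ∃ A', A < A' ∧ ∀ t ∈ (Finset.range A).powerset,
      t ∈ segClosure F → t ∉ F → ∃ z ∈ convexHull ℝ ((fun n => φ (insert n t)) ''
        {n | n ∈ M ∧ A ≤ n ∧ n < A' ∧ insert n t ∈ segClosure F}),
        dist z (φ t) < ε * (1 / 2) ^ (m + 1) := by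
    intro A m
    refine ((eventually_gt_atTop A).and ((Finset.eventually_all _).2 fun t _ => ?_)).exists
    by_cases ht : t ∈ segClosure F ∧ t ∉ F
    · obtain ⟨N', hN'⟩ := hF.exists_forall_insert_mem ht.1 ht.2
      have hS : M ∩ Set.Ici A ∩ Set.Ici N' ∈ (U : Filter ℕ) :=
        inter_mem (inter_mem hM (hU (Ici_mem_atTop A))) (hU (Ici_mem_atTop N'))
      filter_upwards [eventually_exists_mem_convexHull_dist_lt (hφ t ht.1 ht.2) hS
        (show 0 < ε * (1 / 2) ^ (m + 1) by positivity)] with A' ⟨z, hz, hzt⟩ _ _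
      refine ⟨z, convexHull_mono (Set.image_mono ?_) hz, hzt⟩
      rintro n ⟨⟨⟨h1, h2⟩, h3⟩, h4⟩
      exact ⟨h1, h2, h4, (hN' n h3).2⟩
    · exact Eventually.of_forall fun _ h1 h2 => absurd ⟨h1, h2⟩ ht
  choose f hfA hf using hstep
  let a : ℕ → ℕ := fun k => Nat.rec N (fun m A => f A m) k
  exact ⟨a, strictMono_nat_of_lt_succ fun m => hfA _ _, le_rfl, fun m t ht htF hta =>
    hf (a m) m t (Finset.mem_powerset.2 fun i hi => Finset.mem_range.2 (hta i hi)) ht htF⟩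

/-- The finite sets whose element number `k` lies in the interval `[a j, a (j + 1))` for
`j = k * l + i`. -/
def blockSets (a : ℕ → ℕ) (l i : ℕ) : Set (Finset ℕ) :=
  {s | ∀ m ∈ s, a ((s.filter (· < m)).card * l + i) ≤ m ∧
    m < a ((s.filter (· < m)).card * l + i + 1)}

theorem insert_mem_blockSets {a : ℕ → ℕ} {l i : ℕ} {t : Finset ℕ} (ht : t ∈ blockSets a l i)
    {n : ℕ} (hlt : ∀ m ∈ t, m < n) (h1 : a (t.card * l + i) ≤ n)
    (h2 : n < a (t.card * l + i + 1)) : insert n t ∈ blockSets a l i := by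
  intro m hm
  rcases Finset.mem_insert.1 hm with rfl | hm
  · rw [Finset.filter_insert, if_neg (lt_irrefl m), Finset.filter_true_of_mem hlt]
    exact ⟨h1, h2⟩
  · rw [Finset.filter_insert, if_neg (hlt m hm).not_gt]
    exact ht m hm

theorem lt_of_mem_blockSets {a : ℕ → ℕ} (ha : StrictMono a) {l i : ℕ} (hl : 0 < l)
    {t : Finset ℕ} (ht : t ∈ blockSets a l i) {m : ℕ} (hm : m ∈ t) : m < a (t.card * l + i) := by
  refine (ht m hm).2.trans_le (ha.monotone ?_)
  have hc : (t.filter (· < m)).card < t.card :=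
    Finset.card_lt_card (Finset.filter_ssubset.2 ⟨m, hm, lt_irrefl m⟩)
  have := Nat.mul_le_mul_right l (Nat.succ_le_of_lt hc)
  rw [Nat.succ_mul] at this
  omega

theorem nth_mem_of_mem_blockSets {a : ℕ → ℕ} {l i : ℕ} {s : Finset ℕ} (hs : s ∈ blockSets a l i)
    {k : ℕ} (hk : k < s.card) : a (k * l + i) ≤ Nat.nth (· ∈ s) k ∧
      Nat.nth (· ∈ s) k < a (k * l + i + 1) := by
  have hfin : (Set.ofPred (· ∈ s)).Finite := s.finite_toSet
  have hcard : hfin.toFinset = s := by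
    ext n
    exact hfin.mem_toFinset
  have hk' : k < hfin.toFinset.card := by rwa [hcard]
  have h := hs _ (Nat.nth_mem_of_lt_card hfin hk')
  have hc : (s.filter (· < Nat.nth (· ∈ s) k)).card = k := by
    have := Nat.count_nth_of_lt_card_finite hfin hk'
    rw [Nat.count_eq_card_filter_range] at this
    conv_rhs => rw [← this]
    congr 1
    ext n
    simp [and_comm]
  rwa [hc] at h

/-- The `k`-th elements occupy the intervals number `k * l + r i`, which are ordered by `r`; all of
these precede the intervals of level `k + 1` because `r i < l`. -/
theorem isPlegma_of_mem_blockSets {a : ℕ → ℕ} (ha : StrictMono a) {l k : ℕ} {r : Fin k → ℕ}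
    (hr : StrictMono r) (hrl : ∀ i, r i < l) {s : Fin k → Finset ℕ}
    (hs : ∀ i, s i ∈ blockSets a l (r i)) (hne : ∀ i, (s i).Nonempty) : IsPlegma s where
  nonempty := hne
  lt_same i j hij p hi hj :=
    (nth_mem_of_mem_blockSets (hs i) hi).2.trans_le ((ha.monotone (by
      have := hr hij
      omega)).trans (nth_mem_of_mem_blockSets (hs j) hj).1)
  lt_next i j p hi hj :=
    (nth_mem_of_mem_blockSets (hs i) hi).2.trans_le ((ha.monotone (by
      have := hrl i
      rw [Nat.succ_mul]
      omega)).trans (nth_mem_of_mem_blockSets (hs j) hj).1)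

/-- Induction from the leaves to the root: `φ t` is close to a convex combination of values at
extensions inside the next interval of pattern `i`, and the error halves with each level. -/
theorem IsRegularThin.mem_convexHull_add_closedBall {F : Set (Finset ℕ)} (hF : IsRegularThin F)
    {φ : Finset ℕ → X} {M : Set ℕ} {a : ℕ → ℕ} (ha : StrictMono a) {ε : ℝ} (hε : 0 < ε)
    (hφ : ∀ m, ∀ t ∈ segClosure F, t ∉ F →
      (∀ i ∈ t, i < a m) → ∃ z ∈ convexHull ℝ ((fun n => φ (insert n t)) ''
        {n | n ∈ M ∧ a m ≤ n ∧ n < a (m + 1) ∧ insert n t ∈ segClosure F}),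
        dist z (φ t) < ε * (1 / 2) ^ (m + 1)) {l : ℕ} (hl : 0 < l) (i : ℕ) (t : Finset ℕ)
    (ht : t ∈ segClosure F) (htM : (t : Set ℕ) ⊆ M) (hta : t ∈ blockSets a l i) :
    φ t ∈ convexHull ℝ (φ '' (restrict F M ∩ blockSets a l i)) +
      Metric.closedBall (0 : X) (ε * (1 / 2) ^ t.card) := by
  induction t using (wellFounded_treeRel hF.regular.compact).induction with
  | _ t ih =>
  by_cases htF : t ∈ F
  · refine Set.mem_add.2 ⟨φ t, subset_convexHull ℝ _ ⟨t, ⟨⟨htF, htM⟩, hta⟩, rfl⟩, 0,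
      Metric.mem_closedBall_self (by positivity), add_zero _⟩
  obtain ⟨z, hz, hzt⟩ := hφ (t.card * l + i) t ht htF
    fun m hm => lt_of_mem_blockSets ha hl hta hm
  have hsub : convexHull ℝ ((fun n => φ (insert n t)) '' {n | n ∈ M ∧ a (t.card * l + i) ≤ n ∧
      n < a (t.card * l + i + 1) ∧ insert n t ∈ segClosure F}) ⊆
      convexHull ℝ (φ '' (restrict F M ∩ blockSets a l i)) +
        Metric.closedBall (0 : X) (ε * (1 / 2) ^ (t.card + 1)) := by
    -- The hull plus a ball is convex, so it suffices to place each single extension in it.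
    refine convexHull_min ?_ ((convex_convexHull ℝ _).add (convex_closedBall _ _))
    rintro _ ⟨n, ⟨hnM, hn1, hn2, hnF⟩, rfl⟩
    have hlt : ∀ m ∈ t, m < n := fun m hm => (lt_of_mem_blockSets ha hl hta hm).trans_le hn1
    have := ih (insert n t) (treeRel_insert hlt hnF) hnF
      (by
        rw [Finset.coe_insert]
        exact Set.insert_subset hnM htM) (insert_mem_blockSets hta hlt hn1 hn2)
    rwa [Finset.card_insert_of_notMem fun h => lt_irrefl n (hlt n h)] at this
  obtain ⟨y, hy, w, hw, rfl⟩ := Set.mem_add.1 (hsub hz)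
  refine Set.mem_add.2 ⟨y, hy, φ t - y, ?_, add_sub_cancel _ _⟩
  rw [mem_closedBall_zero_iff] at hw ⊢
  have h1 : (1 / 2 : ℝ) ^ (t.card * l + i + 1) ≤ (1 / 2) ^ (t.card + 1) :=
    pow_le_pow_of_le_one (by norm_num) (by norm_num) (by
      have := Nat.le_mul_of_pos_right t.card hl
      omega)
  have h2 : φ t - y = w - (y + w - φ t) := by abel
  rw [dist_eq_norm] at hzt
  calc ‖φ t - y‖ ≤ ‖w‖ + ‖y + w - φ t‖ := h2 ▸ norm_sub_le _ _
    _ ≤ ε * (1 / 2) ^ (t.card + 1) + ε * (1 / 2) ^ (t.card + 1) :=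
      add_le_add hw (hzt.le.trans (mul_le_mul_of_nonneg_left h1 hε.le))
    _ = ε * (1 / 2) ^ t.card := by ring

end Blocks

/-! ### The center of a generating family -/

section Generates

variable {X : Type*} [NormedAddCommGroup X] [NormedSpace ℝ X]
variable {E : Type*} [SeminormedAddCommGroup E] [NormedSpace ℝ E]

/-- If a weakly relatively compact family generates `e`, there are a vector `x₀` and, for all `l`
and `ε`, sets `A 0, …, A (l - 1)` whose convex hulls meet the ball of radius `ε` about `x₀`, such
that the linear combinations of any selection from consecutive sets have up to `ε` the norm of
those of `e`. -/
theorem Generates.exists_center {F : Set (Finset ℕ)} (hF : IsRegularThin F) (hne : F.Nonempty)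
    (hF0 : ∅ ∉ F) {x : Finset ℕ → X} (hx : IsWeaklyRelCompact (x '' F)) {M : Set ℕ}
    (hM : M.Infinite) {e : Module.Basis ℕ ℝ E} (he : Generates F M x e) :
    ∃ x₀ : X, ∀ (l : ℕ) (ε : ℝ), 0 < ε → ∃ A : ℕ → Set X,
      (∀ i < l, ∃ y ∈ convexHull ℝ (A i), ‖y - x₀‖ ≤ ε) ∧
      ∀ m n, m + n ≤ l → ∀ z : ℕ → X, (∀ i < l, z i ∈ A i) →
        ∀ c : ℕ → ℝ, (∀ i < n, |c i| ≤ 1) →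
        |‖∑ i ∈ Finset.range n, c i • z (m + i)‖ - ‖∑ i ∈ Finset.range n, c i • e i‖| ≤ ε := by
  obtain ⟨U, hU, hMU⟩ := hM.exists_ultrafilter_le_atTop
  obtain ⟨ψ, hψx, hψ⟩ := hF.exists_limit_map U hU hx (fun s => toWeakSpace ℝ X (x s))
    fun s hs => subset_closure (Set.mem_image_of_mem _ (Set.mem_image_of_mem x hs))
  set φ : Finset ℕ → X := fun t => (toWeakSpace ℝ X).symm (ψ t) with hφ
  have hφψ : ∀ t, toWeakSpace ℝ X (φ t) = ψ t := fun t => LinearEquiv.apply_symm_apply _ _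
  have hφx : ∀ s ∈ F, φ s = x s := fun s hs => by
    simp only [hφ, hψx s hs, LinearEquiv.symm_apply_apply]
  obtain ⟨δ, -, hδ, hgen⟩ := he
  refine ⟨φ ∅, fun l ε hε => ?_⟩
  -- `p` is the error index in `Generates`. The intervals start at the element number `p` of `M`, so
  -- that every tuple selected from them is admissible.
  obtain ⟨p, hpl, hp⟩ := ((eventually_ge_atTop l).and
    (hδ.eventually (eventually_lt_nhds hε))).exists
  obtain ⟨a, ha, haN, hconv⟩ := hF.exists_strictMono_convexHull hU (φ := φ)
    (fun t ht htF => by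
      simp only [hφψ]
      exact (hψ t ht).2 htF) hMU (Nat.nth (· ∈ M) p) hε
  refine ⟨fun i => φ '' (restrict F M ∩ blockSets a l i), fun i hi => ?_, ?_⟩
  · obtain ⟨s₀, hs₀⟩ := hne
    obtain ⟨y, hy, w, hw, hyw⟩ := Set.mem_add.1 (hF.mem_convexHull_add_closedBall ha hε hconv
      (Nat.zero_lt_of_lt hi) i ∅ ⟨s₀, hs₀, isInitSeg_empty s₀⟩ (by simp)
      fun m hm => absurd hm (Finset.notMem_empty m))
    refine ⟨y, hy, ?_⟩
    rw [← hyw, sub_add_cancel_left, norm_neg]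
    simpa using hw
  · intro m n hmn z hz c hc
    cases n with
    | zero => simpa using hε.le
    | succ k =>
    choose! s hs hsz using hz
    have hlt : ∀ i : Fin (k + 1), m + i < l := fun i => by omega
    have hnonempty : ∀ i : Fin (k + 1), (s (m + i)).Nonempty := fun i =>
      Finset.nonempty_iff_ne_empty.2 fun h => hF0 (h ▸ (hs _ (hlt i)).1.1)
    have h := hgen k p (by omega) (fun i => s (m + i)) (fun i => (hs _ (hlt i)).1)
      (isPlegma_of_mem_blockSets ha (r := fun i : Fin (k + 1) => m + (i : ℕ))
        (fun i j hij => Nat.add_lt_add_left hij m) hlt (fun i => (hs _ (hlt i)).2) hnonempty)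
      (haN.trans ((ha.monotone (Nat.zero_le _)).trans (nth_mem_of_mem_blockSets
        (hs _ (hlt 0)).2 (Finset.card_pos.2 (hnonempty 0))).1))
      (fun i => c i) (fun i => abs_le.1 (hc i i.2))
    rw [Finset.sum_range, Finset.sum_range]
    refine le_trans (le_of_eq ?_) (h.trans hp.le)
    congr 3
    refine Finset.sum_congr rfl fun i _ => ?_
    rw [← hsz _ (hlt i), hφx _ (hs _ (hlt i)).1.1]

/-- By thinness, `∅ ∈ F` leaves no proper extension of the root, which then has rank `0`. -/
theorem ne_empty_and_empty_notMem_of_order {F : Set (Finset ℕ)} (hF : IsRegularThin F)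
    {ξ : Ordinal.{0}} (h : order F = (ξ : WithBot Ordinal.{0})) (hξ : 1 ≤ ξ) :
    F.Nonempty ∧ ∅ ∉ F := by
  have hne : F ≠ ∅ := fun h0 => by
    rw [order, if_pos h0] at h
    exact WithBot.bot_ne_coe h
  refine ⟨Set.nonempty_iff_ne_empty.2 hne, fun h0 => ?_⟩
  rw [order, if_neg hne, dif_pos (wellFounded_treeRel hF.regular.compact), WithBot.coe_inj] at h
  rw [← h, Order.one_le_iff_pos, Acc.rank_eq] at hξ
  obtain ⟨⟨t, ht⟩, -⟩ := (Ordinal.lt_iSup_iff).1 hξ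
  exact ht.2.2.2 (hF.thin.eq_of_isInitSeg h0 ht.1 (isInitSeg_empty t))

end Generates

end SpreadingModel

namespace SpreadingModel

open Filter Topology

/-! ### Unconditionality -/

section Unconditional

variable {X : Type*} [NormedAddCommGroup X] [NormedSpace ℝ X]
variable {E : Type*} [SeminormedAddCommGroup E] [NormedSpace ℝ E]

/-- A norm bound for linear combinations of arbitrary selections from sets passes to
selections from their convex hulls. -/
theorem norm_sum_smul_le_of_mem_convexHull {l : ℕ} {A : ℕ → Set X} {m n : ℕ} (hmn : m + n ≤ l)
    {c : ℕ → ℝ} {R : ℝ} (h : ∀ z : ℕ → X, (∀ i < l, z i ∈ A i) →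
      ‖∑ i ∈ Finset.range n, c i • z (m + i)‖ ≤ R) {w : ℕ → X}
    (hw : ∀ i < l, w i ∈ convexHull ℝ (A i)) :
    ‖∑ i ∈ Finset.range n, c i • w (m + i)‖ ≤ R := by
  -- The combination is one linear map of the whole tuple, and a product of convex hulls lies in the
  -- convex hull of the product.
  let T : (Fin l → X) →ₗ[ℝ] X :=
    ∑ i : Fin n, c i • LinearMap.proj (⟨m + i, by omega⟩ : Fin l)
  have hT : ∀ z : ℕ → X, T (fun i => z i) = ∑ i ∈ Finset.range n, c i • z (m + i) := fun z => by
    simp [T, Finset.sum_range]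
  have hsub : convexHull ℝ (Set.univ.pi fun i : Fin l => A i) ⊆ T ⁻¹' Metric.closedBall 0 R := by
    refine convexHull_min (fun z hz => ?_) ((convex_closedBall (0 : X) R).linear_preimage T)
    obtain ⟨z', hz'⟩ : ∃ z' : ℕ → X, ∀ i : Fin l, z' i = z i :=
      ⟨fun j => if hj : j < l then z ⟨j, hj⟩ else 0, fun i => dif_pos i.2⟩
    rw [Set.mem_preimage, mem_closedBall_zero_iff, ← funext hz', hT]
    exact h _ fun i hi => (hz' ⟨i, hi⟩).symm ▸ hz ⟨i, hi⟩ (Set.mem_univ _)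
  have := hsub (mem_convexHull_pi (x := fun i : Fin l => w i) fun i _ => hw i i.2)
  rwa [Set.mem_preimage, mem_closedBall_zero_iff, hT] at this

theorem sum_range_add_self_ite {V : Type*} [AddCommGroup V] [Module ℝ V] (b : ℕ → ℝ) (n : ℕ)
    (v : ℕ → V) :
    ∑ i ∈ Finset.range (n + n), (if i < n then b i else -b (i - n)) • v i =
      ∑ i ∈ Finset.range n, b i • v i - ∑ i ∈ Finset.range n, b i • v (n + i) := by
  rw [Finset.sum_range_add, sub_eq_add_neg, ← Finset.sum_neg_distrib]
  congr 1
  · exact Finset.sum_congr rfl fun i hi => by rw [if_pos (Finset.mem_range.1 hi)]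
  · exact Finset.sum_congr rfl fun i _ => by simp

-- Replacing the terms outside `S` by vectors near `x₀` costs almost nothing in norm. Doing so in
-- two disjoint blocks of length `n` and subtracting eliminates the unknown `x₀`.
open Classical in
theorem norm_sum_sub_shift_le {e : ℕ → E} {x₀ : X}
    (h : ∀ (l : ℕ) (ε : ℝ), 0 < ε → ∃ A : ℕ → Set X,
      (∀ i < l, ∃ y ∈ convexHull ℝ (A i), ‖y - x₀‖ ≤ ε) ∧
      ∀ m n, m + n ≤ l → ∀ z : ℕ → X, (∀ i < l, z i ∈ A i) →
        ∀ c : ℕ → ℝ, (∀ i < n, |c i| ≤ 1) →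
        |‖∑ i ∈ Finset.range n, c i • z (m + i)‖ - ‖∑ i ∈ Finset.range n, c i • e i‖| ≤ ε)
    (n : ℕ) {c : ℕ → ℝ} (hc : ∀ i < n, |c i| ≤ 1) (S : Set ℕ) :
    ‖∑ i ∈ Finset.range n, S.indicator c i • e i -
      ∑ i ∈ Finset.range n, S.indicator c i • e (n + i)‖ ≤
      2 * ‖∑ i ∈ Finset.range n, c i • e i‖ := by
  set r := ‖∑ i ∈ Finset.range n, c i • e i‖
  have hb : ∀ i < n, |S.indicator c i| ≤ 1 := fun i hi => by
    by_cases hiS : i ∈ S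
    · rw [Set.indicator_of_mem hiS]
      exact hc i hi
    · rw [Set.indicator_of_notMem hiS]
      simp
  have key : ∀ ε : ℝ, 0 < ε → ‖∑ i ∈ Finset.range n, S.indicator c i • e i -
      ∑ i ∈ Finset.range n, S.indicator c i • e (n + i)‖ ≤ 2 * r + (2 * n + 3) * ε := by
    intro ε hε
    obtain ⟨A, hA, hAe⟩ := h (n + n) ε hε
    choose! y hy hyx using hA
    have hne : ∀ i < n + n, ∃ z, z ∈ A i := fun i hi => convexHull_nonempty_iff.1 ⟨y i, hy i hi⟩
    choose! z hz using hne
    have hhalf : ∀ m, m + n ≤ n + n →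
        ‖∑ i ∈ Finset.range n, S.indicator c i • z (m + i) +
          (∑ i ∈ Finset.range n, Sᶜ.indicator c i) • x₀‖ ≤ r + (n + 1) * ε := by
      intro m hm
      -- On `S` keep an actual selection, off `S` use the convex combination near `x₀`. The shift `j
      -- - m` makes both blocks follow the same `S`.
      set w : ℕ → X := fun j => if j - m ∈ S then z j else y j with hw
      have h1 : ‖∑ i ∈ Finset.range n, c i • w (m + i)‖ ≤ r + ε := by
        refine norm_sum_smul_le_of_mem_convexHull (A := A) hm (fun z hz => ?_) fun i hi => ?_
        · exact sub_le_iff_le_add'.1 (abs_le.1 (hAe m n hm z hz c hc)).2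
        · simp only [hw]
          split_ifs
          · exact subset_convexHull ℝ _ (hz i hi)
          · exact hy i hi
      have h2 : ∑ i ∈ Finset.range n, S.indicator c i • z (m + i) +
          (∑ i ∈ Finset.range n, Sᶜ.indicator c i) • x₀ =
          ∑ i ∈ Finset.range n, c i • w (m + i) -
          ∑ i ∈ Finset.range n, Sᶜ.indicator c i • (y (m + i) - x₀) := by
        rw [Finset.sum_smul, ← Finset.sum_add_distrib, ← Finset.sum_sub_distrib]
        refine Finset.sum_congr rfl fun i _ => ?_
        by_cases hiS : i ∈ S
        · simp [hw, hiS]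
        · simp [hw, hiS, smul_sub]
      have h3 : ‖∑ i ∈ Finset.range n, Sᶜ.indicator c i • (y (m + i) - x₀)‖ ≤ n * ε := by
        refine (norm_sum_le_of_le (f := fun i => Sᶜ.indicator c i • (y (m + i) - x₀))
          (n := fun _ => ε) _ fun i hi => ?_).trans_eq (by simp)
        have hi' := Finset.mem_range.1 hi
        rw [norm_smul]
        refine (mul_le_mul ?_ (hyx (m + i) (by omega)) (norm_nonneg _) zero_le_one).trans_eq
          (one_mul ε)
        refine (norm_indicator_le_norm_self c i).trans (hc i hi')
      rw [h2]
      have := norm_sub_le (∑ i ∈ Finset.range n, c i • w (m + i))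
        (∑ i ∈ Finset.range n, Sᶜ.indicator c i • (y (m + i) - x₀))
      linarith
    have hz0 := hhalf 0 (by omega)
    have hzn := hhalf n le_rfl
    -- One selection of length `n + n`, with the signs of its second half reversed, transfers the
    -- difference bound to `e`. Total error: `(n + 1) * ε` from each block and `ε` from here.
    have hfull := hAe 0 (n + n) (by omega) z hz
      (fun i => if i < n then S.indicator c i else -S.indicator c (i - n)) (fun i hi => by
        split_ifs with hin
        · exact hb i hin
        · rw [abs_neg]
          exact hb _ (by omega))
    simp only [zero_add] at hfull hz0
    rw [sum_range_add_self_ite, sum_range_add_self_ite] at hfull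
    have h1 := norm_sub_le (∑ i ∈ Finset.range n, S.indicator c i • z i +
      (∑ i ∈ Finset.range n, Sᶜ.indicator c i) • x₀)
      (∑ i ∈ Finset.range n, S.indicator c i • z (n + i) +
      (∑ i ∈ Finset.range n, Sᶜ.indicator c i) • x₀)
    rw [add_sub_add_right_eq_sub] at h1
    have h2 := (abs_le.1 hfull).1
    linarith
  refine le_of_forall_pos_le_add fun η hη => ?_
  have hpos : (0 : ℝ) < 2 * n + 3 := by positivity
  have := key (η / (2 * n + 3)) (div_pos hη hpos)
  rwa [mul_div_cancel₀ _ hpos.ne'] at this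

/-- The estimate of `norm_sum_sub_shift_le` extends from bounded to arbitrary coefficients. -/
theorem norm_sum_sub_shift_le_of_forall {e : ℕ → E} {S : Set ℕ} {n : ℕ}
    (h : ∀ c : ℕ → ℝ, (∀ i < n, |c i| ≤ 1) → ‖∑ i ∈ Finset.range n, S.indicator c i • e i -
      ∑ i ∈ Finset.range n, S.indicator c i • e (n + i)‖ ≤
      2 * ‖∑ i ∈ Finset.range n, c i • e i‖) (c : ℕ → ℝ) :
    ‖∑ i ∈ Finset.range n, S.indicator c i • e i -
      ∑ i ∈ Finset.range n, S.indicator c i • e (n + i)‖ ≤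
      2 * ‖∑ i ∈ Finset.range n, c i • e i‖ := by
  set R : ℝ := 1 + ∑ i ∈ Finset.range n, |c i| with hR
  have hR0 : 0 < R := by positivity
  have hcR : ∀ i < n, |c i| ≤ R := fun i hi => by
    have := Finset.single_le_sum (f := fun i => |c i|) (fun i _ => abs_nonneg _)
      (Finset.mem_range.2 hi)
    linarith
  have hR' : R⁻¹ ≠ 0 := (inv_pos.2 hR0).ne'
  have key := h (R⁻¹ • c) fun i hi => by
    rw [Pi.smul_apply, smul_eq_mul, abs_mul, abs_of_pos (inv_pos.2 hR0), inv_mul_le_one₀ hR0]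
    exact hcR i hi
  have hind : ∀ i, S.indicator (R⁻¹ • c) i = R⁻¹ • S.indicator c i :=
    Set.indicator_const_smul_apply S R⁻¹ c
  simp only [hind, Pi.smul_apply, smul_assoc, ← Finset.smul_sum, ← smul_sub, norm_smul] at key
  rw [mul_left_comm] at key
  exact le_of_mul_le_mul_left key (norm_pos_iff.2 hR')

/-! ### From basis projections to unconditionality -/

/-- The partial-sum projections are uniformly bounded, and the `n`-th one kills every `x (n + i)`.
-/
theorem IsSchauderBasic.exists_norm_sum_le {V : Type*} [NormedAddCommGroup V] [NormedSpace ℝ V]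
    [CompleteSpace V] {x : ℕ → V} (hx : IsSchauderBasic x) :
    ∃ C : ℝ, 0 < C ∧ ∀ (n : ℕ) (c d : ℕ → ℝ), ‖∑ i ∈ Finset.range n, c i • x i‖ ≤
      C * ‖∑ i ∈ Finset.range n, c i • x i - ∑ i ∈ Finset.range n, d i • x (n + i)‖ := by
  obtain ⟨b, hb⟩ := hx
  obtain ⟨C, hC⟩ := SchauderBasis.exists_norm_proj_le b
  refine ⟨max C 1, lt_max_of_lt_right one_pos, fun n c d => ?_⟩
  set v := ∑ i ∈ Finset.range n, c i • b i - ∑ i ∈ Finset.range n, d i • b (n + i)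
  have h1 : SchauderBasis.proj b n v = ∑ i ∈ Finset.range n, c i • b i := by
    simp only [v, map_sub, map_sum, map_smul, SchauderBasis.proj_apply_basis_mem]
    rw [Finset.sum_eq_zero (s := Finset.range n) (f := fun i => d i • if n + i < n then _ else _)
      fun i _ => by simp, sub_zero]
    exact Finset.sum_congr rfl fun i hi => by rw [if_pos (Finset.mem_range.1 hi)]
  have h2 := (SchauderBasis.proj b n).le_of_opNorm_le ((hC n).trans (le_max_left C 1)) v
  rw [h1] at h2
  simpa [v, hb, Submodule.coe_norm] using h2

/-- Restriction to `S` commutes with restriction to a tail, so the finite bound applied to tails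
transfers the Cauchy property; the norm bound then passes to the limit. -/
theorem isUnconditional_of_norm_sum_indicator_le {V : Type*} [NormedAddCommGroup V]
    [NormedSpace ℝ V] [CompleteSpace V] {x : ℕ → V} {C : ℝ} (hC : 0 < C)
    (h : ∀ (S : Set ℕ) (c : ℕ → ℝ) (n : ℕ), ‖∑ i ∈ Finset.range n, S.indicator c i • x i‖ ≤
      C * ‖∑ i ∈ Finset.range n, c i • x i‖) : IsUnconditional x := by
  classical
  refine ⟨C, hC, fun S a y hy => ?_⟩
  have hS : ∀ i, (if i ∈ S then a i • x i else 0) = S.indicator a i • x i := fun i => by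
    by_cases hi : i ∈ S <;> simp [hi]
  have htail : ∀ (b : ℕ → ℝ) (m n : ℕ), m ≤ n →
      ∑ i ∈ Finset.range n, (Set.Ici m).indicator b i • x i =
        ∑ i ∈ Finset.range n, b i • x i - ∑ i ∈ Finset.range m, b i • x i := by
    intro b m n hmn
    rw [← Finset.sum_range_add_sum_Ico _ hmn, ← Finset.sum_range_add_sum_Ico _ hmn,
      add_sub_cancel_left, Finset.sum_eq_zero, zero_add]
    · refine Finset.sum_congr rfl fun i hi => ?_
      rw [Set.indicator_of_mem (Set.mem_Ici.2 (Finset.mem_Ico.1 hi).1)]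
    · intro i hi
      rw [Set.indicator_of_notMem (Set.notMem_Ici.2 (Finset.mem_range.1 hi)), zero_smul]
  have hcau : CauchySeq fun n => ∑ i ∈ Finset.range n, S.indicator a i • x i := by
    rw [Metric.cauchySeq_iff']
    intro ε hε
    obtain ⟨N, hN⟩ := Metric.cauchySeq_iff'.1 hy.cauchySeq (ε / C) (div_pos hε hC)
    refine ⟨N, fun n hn => ?_⟩
    have h1 := h S ((Set.Ici N).indicator a) n
    have h2 : S.indicator ((Set.Ici N).indicator a) = (Set.Ici N).indicator (S.indicator a) := by
      rw [Set.indicator_indicator, Set.indicator_indicator, Set.inter_comm]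
    rw [h2, htail _ _ _ hn, htail _ _ _ hn, ← dist_eq_norm, ← dist_eq_norm] at h1
    exact h1.trans_lt ((lt_div_iff₀' hC).1 (hN n hn))
  obtain ⟨z, hz⟩ := cauchySeq_tendsto_of_complete hcau
  refine ⟨z, ?_, le_of_tendsto_of_tendsto' hz.norm (hy.norm.const_mul C) fun n => h S a n⟩
  simpa only [hS] using hz

theorem isUnconditional_of_mem_wrcSpreadingModels {e : Module.Basis ℕ ℝ E}
    (he : e ∈ wrcSpreadingModels X E)
    (hb : IsSchauderBasic fun n => (e n : UniformSpace.Completion E)) :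
    IsUnconditional fun n => (e n : UniformSpace.Completion E) := by
  obtain ⟨ξ, hξ, -, A, hA, F, hF, hord, x, hxA, M, hM, hgen⟩ := he
  obtain ⟨hne, hF0⟩ := ne_empty_and_empty_notMem_of_order hF hord hξ
  have hx : IsWeaklyRelCompact (x '' F) := hA.of_isClosed_subset isClosed_closure
    (closure_mono (Set.image_mono (Set.image_subset_iff.2 hxA)))
  obtain ⟨x₀, hx₀⟩ := hgen.exists_center hF hne hF0 hx hM
  obtain ⟨C, hC, hCe⟩ := hb.exists_norm_sum_le
  refine isUnconditional_of_norm_sum_indicator_le (mul_pos hC two_pos) fun S c n => ?_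
  refine (hCe n (S.indicator c) (S.indicator c)).trans ?_
  have h := norm_sum_sub_shift_le_of_forall (fun c hc => norm_sum_sub_shift_le hx₀ n hc S) c
  rw [mul_assoc]
  refine mul_le_mul_of_nonneg_left ?_ hC.le
  have hcoe : ∀ (b : ℕ → ℝ) (j : ℕ → ℕ),
      ∑ i ∈ Finset.range n, b i • (e (j i) : UniformSpace.Completion E) =
        ((∑ i ∈ Finset.range n, b i • e (j i) : E) : UniformSpace.Completion E) := fun b j => by
    simp only [← UniformSpace.Completion.coe_toComplL (𝕜 := ℝ), map_sum, map_smul]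
  rw [hcoe _ fun i => i, hcoe _ fun i => n + i, hcoe _ fun i => i,
    ← UniformSpace.Completion.coe_sub, UniformSpace.Completion.norm_coe,
    UniformSpace.Completion.norm_coe]
  exact h

end Unconditional

end SpreadingModel

theorem mainTheorem6
    {X : Type*} [NormedAddCommGroup X] [NormedSpace ℝ X] [CompleteSpace X] :
    (∀ {E : Type*} [SeminormedAddCommGroup E] [NormedSpace ℝ E] (e : Module.Basis ℕ ℝ E),
      e ∈ SpreadingModel.wrcSpreadingModels X E →
      SpreadingModel.IsSchauderBasic (fun n => (e n : UniformSpace.Completion E)) →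
      SpreadingModel.IsUnconditional (fun n => (e n : UniformSpace.Completion E))) ∧
    (∀ (F : Set (Finset ℕ)) (x : Finset ℕ → X), SpreadingModel.IsRegularThin F →
      SpreadingModel.IsWeaklyRelCompact (x '' F) →
      ∀ M : Set ℕ, M.Infinite → ∃ L ⊆ M, L.Infinite ∧
        SpreadingModel.IsSubordinated F L (fun s => toWeakSpace ℝ X (x s))) :=
  ⟨fun _ he hb => SpreadingModel.isUnconditional_of_mem_wrcSpreadingModels he hb,
    fun _ _ hF hx _ hM => hF.exists_weakly_subordinated hx hM⟩
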